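/- Let $k$ be an algebraically closed field of characteristic $p\ge 3$ and let $(\mathfrak g,[p])$ be a finite-dimensional restricted Lie algebra over $k$, with restricted nullcone $V(\mathfrak g)=\{x\in\mathfrak g : x^{[p]}=0\}$. Let $\mathrm{Gr}_2(\mathfrak g)$ be the Grassmannian of $2$-dimensional subspaces of $\mathfrak g$ with its Zariski topology, and let $\mathrm{Gr}_2(\mathfrak g)^{V(\mathfrak g)}=\{\mathfrak v\in \mathrm{Gr}_2(\mathfrak g) : \mathfrak v\subseteq V(\mathfrak g)\}$. Let $\mathcal X\subseteq \mathrm{Gr}_2(\mathfrak g)^{V(\mathfrak g)}$ be a closed subset, put $V_{\mathcal X}=\bigcup_{\mathfrak v\in\mathcal X}\mathfrak v$, and let $\mathbb P(V_{\mathcal X})\subseteq\mathbb P(\mathfrak g)$ be the set of lines contained in $V_{\mathcal X}$. Let $\varphi:\mathbb P(V_{\mathcal X})\to\mathbb P^m$ be a morphism of varieties. For $\mathfrak v\in\mathcal X$, a reduced defining system of degree $d$ for $\varphi|_{\mathbb P(\mathfrak v)}$ is a tuple $(f_0,\dots,f_m)$ of homogeneous polynomial functions of degree $d$ on $\mathfrak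 v$ with $\gcd(f_0,\dots,f_m)=1$ and $\varphi(x)=(f_0(x):\cdots:f_m(x))$ for all $x\in\mathbb P(\mathfrak v)$. Such a system exists and its degree $d$ is uniquely determined; write $\deg(\varphi|_{\mathbb P(\mathfrak v)})=d$. Then: 1. The map $\mathcal X\to\mathbb N_0$, $\mathfrak v\mapsto\deg(\varphi|_{\mathbb P(\mathfrak v)})$, is locally constant. 2. If $\mathcal X$ is connected, then this map is constant. -/

import Mathlib

open scoped LinearAlgebra.Projectivization

noncomputable section

namespace RestrLie

/-! ### Restricted Lie algebras -/

section PMap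

variable (k : Type*) [Field k] {g : Type*} [LieRing g] [LieAlgebra k g]

/-- The term `s_i(x, y)` of Jacobson's formula: `i • s_i(x, y)` is the coefficient of `t ^ (i - 1)`
in `(ad (t x + y)) ^ (p - 1) (x)`. Here `ad (t x + y) = t ad x + ad y` is viewed as a polynomial in
the central variable `t` with coefficients in `End g`. Only used for `1 ≤ i ≤ p - 1`. -/
def jacobsonTerm (p i : ℕ) (x y : g) : g :=
  (i : k)⁻¹ •
    (((Polynomial.C (LieAlgebra.ad k g x) * Polynomial.X +
      Polynomial.C (LieAlgebra.ad k g y)) ^ (p - 1)).coeff (i - 1)) x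

variable (g) in
/-- A `p`-map on a Lie algebra `g` over a field of characteristic `p`, in the sense of Jacobson;
the pair consisting of `g` and a `p`-map is a restricted Lie algebra. -/
structure PMap (p : ℕ) where
  /-- the map `x ↦ x^[p]` -/
  pmap : g → g
  ad_pmap : ∀ x : g, LieAlgebra.ad k g (pmap x) = LieAlgebra.ad k g x ^ p
  pmap_smul : ∀ (c : k) (x : g), pmap (c • x) = c ^ p • pmap x
  pmap_add : ∀ x y : g,
    pmap (x + y) = pmap x + pmap y + ∑ i ∈ Finset.Icc 1 (p - 1), jacobsonTerm k p i x y

variable {k}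

/-- The restricted nullcone `V(g) = {x | x^[p] = 0}`. -/
def PMap.nullcone {p : ℕ} (P : PMap k g p) : Set g := {x | P.pmap x = 0}

end PMap

/-! ### Polynomial functions, the Zariski topology on a projective space, morphisms -/

section Projective

variable (k : Type*) [Field k] (V : Type*) [AddCommGroup V] [Module k V]

/-- The algebra of polynomial functions on `V`: the `k`-algebra of functions on `V` generated by
the linear forms. (For `k` infinite and `V` finite-dimensional it is the symmetric algebra on the
dual of `V`.) -/
def polyFun : Subalgebra k (V → k) :=
  Algebra.adjoin k (Set.range fun ξ : Module.Dual k V => (ξ : V → k))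

variable {k V}

/-- `f` is homogeneous of degree `d` (over an infinite field, this is equivalent to lying in the
degree `d` component of the algebra of polynomial functions). -/
def IsHomog (d : ℕ) (f : polyFun k V) : Prop :=
  ∀ (c : k) (x : V), (f : V → k) (c • x) = c ^ d * (f : V → k) x

/-- The Zariski topology on the projective space of lines in `V`, generated by the sets `{f ≠ 0}`
for homogeneous polynomial functions `f`. Its closed sets are the loci of common zeros of families
of homogeneous polynomial functions. -/
instance zariskiProj : TopologicalSpace (ℙ k V) :=
  TopologicalSpace.generateFrom
    {U | ∃ (d : ℕ) (f : polyFun k V), IsHomog d f ∧ U = {ℓ | (f : V → k) ℓ.rep ≠ 0}}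

/-- `h` is a regular function on the (locally closed) subset `Y` of a projective space: locally on
`Y` it is a quotient of two homogeneous polynomial functions of the same degree. Only the values
of `h` on `Y` matter. -/
def IsRegularOn (h : ℙ k V → k) (Y : Set (ℙ k V)) : Prop :=
  ∀ y ∈ Y, ∃ O : Set (ℙ k V), IsOpen O ∧ y ∈ O ∧
    ∃ (d : ℕ) (a b : polyFun k V), IsHomog d a ∧ IsHomog d b ∧
      ∀ z ∈ O ∩ Y, (b : V → k) z.rep ≠ 0 ∧ h z = (a : V → k) z.rep / (b : V → k) z.rep

/-- `φ` restricts to a morphism of varieties on the (locally closed) subset `Y` of a projective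
space: it is continuous on `Y` and pulls back regular functions on open subsets of the target to
regular functions. Only the values of `φ` on `Y` matter. -/
def IsMorphismOn {W : Type*} [AddCommGroup W] [Module k W]
    (φ : ℙ k V → ℙ k W) (Y : Set (ℙ k V)) : Prop :=
  ContinuousOn φ Y ∧
    ∀ (U : Set (ℙ k W)) (h : ℙ k W → k), IsOpen U → IsRegularOn h U →
      IsRegularOn (h ∘ φ) (Y ∩ φ ⁻¹' U)

/-- `P(S)`: the set of the lines spanned by the nonzero elements of a conical subset `S`. -/
def projSet (S : Set V) : Set (ℙ k V) :=
  {ℓ | ∃ (x : V) (hx : x ≠ 0), x ∈ S ∧ ℓ = Projectivization.mk k x hx}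

/-- `ψ : P(V) → P^m` has a reduced defining system `(f_0, …, f_m)` consisting of homogeneous
polynomial functions of degree `d`: one has `ψ(x) = (f_0(x) : ⋯ : f_m(x))` for all `x`, and every
common divisor of the `f_i` in the algebra of polynomial functions is a unit. -/
def HasReducedSystem {m : ℕ} (ψ : ℙ k V → ℙ k (Fin (m + 1) → k)) (d : ℕ) : Prop :=
  ∃ f : Fin (m + 1) → polyFun k V,
    (∀ i, IsHomog d (f i)) ∧
    (∀ q : polyFun k V, (∀ i, q ∣ f i) → IsUnit q) ∧
    ∀ (x : V) (hx : x ≠ 0), ∃ hf : (fun i => (f i : V → k) x) ≠ 0,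
      ψ (Projectivization.mk k x hx) = Projectivization.mk k (fun i => (f i : V → k) x) hf

/-- The degree of a morphism `P(V) → P^m`: the degree of a reduced defining system. -/
def projDegree {m : ℕ} (ψ : ℙ k V → ℙ k (Fin (m + 1) → k)) : ℕ :=
  sInf {d | HasReducedSystem ψ d}

/-- The restriction `φ|_{P(W)}` of `φ` to the projective space of a linear subspace `W`. -/
def restrictProj {T : Type*} (φ : ℙ k V → T) (W : Submodule k V) : ℙ k W → T :=
  φ ∘ Projectivization.map W.subtype W.subtype_injective

end Projective

/-! ### Grassmannians -/

section Grassmannian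

variable (k : Type*) [Field k] (V : Type*) [AddCommGroup V] [Module k V]

/-- The Grassmannian of `r`-dimensional subspaces of `V`. -/
def Gr (r : ℕ) : Type _ := {W : Submodule k V // Module.finrank k W = r}

variable {k V}

/-- The subspace of `V` given by a point of the Grassmannian. -/
def Gr.space {r : ℕ} (v : Gr k V r) : Submodule k V := v.1

theorem ιMulti_ne_zero {r : ℕ} {b : Fin r → V} (hb : LinearIndependent k b) :
    exteriorPower.ιMulti k r b ≠ 0 := by
  have h := (exteriorPower.ιMulti_family_linearIndependent_field (n := r) hb).ne_zero
    (Set.powersetCard.ofFinEmbEquiv (RelEmbedding.refl _))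
  simpa [exteriorPower.ιMulti_family] using h

variable [FiniteDimensional k V]

/-- A basis `b_1, …, b_r` of an `r`-dimensional subspace. -/
def Gr.basis {r : ℕ} (v : Gr k V r) : Module.Basis (Fin r) k v.space :=
  Module.finBasisOfFinrankEq k v.space v.2

/-- The Plücker embedding, sending an `r`-dimensional subspace with basis `b_1, …, b_r` to the line
spanned by `b_1 ∧ ⋯ ∧ b_r`. -/
def plucker {r : ℕ} (v : Gr k V r) : ℙ k (⋀[k]^r V) :=
  Projectivization.mk k (exteriorPower.ιMulti k r fun i => (v.basis i : V))
    (ιMulti_ne_zero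
      (v.basis.linearIndependent.map' v.space.subtype (Submodule.ker_subtype _)))

/-- The Zariski topology on the Grassmannian, induced by the Plücker embedding. -/
instance zariskiGr {r : ℕ} : TopologicalSpace (Gr k V r) :=
  TopologicalSpace.induced plucker inferInstance

/-- `Gr_r(V)^S`: the set of those `r`-dimensional subspaces that are contained in the subset `S`. -/
def Gr.inside (r : ℕ) (S : Set V) : Set (Gr k V r) := {v | (v.space : Set V) ⊆ S}

/-- The union `⋃_{v ∈ X} v` of the subspaces belonging to `X`. -/
def Gr.union {r : ℕ} (X : Set (Gr k V r)) : Set V := ⋃ v ∈ X, (v.space : Set V)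

end Grassmannian

end RestrLie

end

open RestrLie

namespace RestrLie

/-! ### Polynomial functions and forms -/

section PolyFun

variable {k : Type*} [Field k] {U V : Type*} [AddCommGroup U] [Module k U]
  [AddCommGroup V] [Module k V]

/-! On a plane, `φ` has a defining system `f` without common zeros. Binary forms can be divided by
linear forms at their zeros, so every tuple of forms proportional to `φ` there is `c * f` for a
single form `c` (`IsDefiningSystem.exists_eq_mul`).

Fix `v₀` in `X`. Finitely many local representations of `φ`, brought to a common degree `e`, form a
matrix `M` of forms on `g` whose entries have no common zero on `v₀`
(`LocallyGivenByForms.exists_finite_family`). On each plane of `X` near `v₀` the matrix factors as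
`c ⊗ f`, whence `e = deg c + deg f`; on `v₀` neither factor has a common zero.

Neither degree can drop near `v₀` (`exists_form_le_degree`). A second factor of degree below `d =
deg f₀` could be padded by a power of a linear form to a nonzero tuple `A` of degree `d - 1` with `M
a j * A i = M a i * A j`. On `v₀` these linear equations force `A = 0`, because their solutions are
multiples of `f₀`, and injectivity of a linear system persists where some determinant is nonzero.
Applied to `M` and to its transpose, this bounds both degrees from below; their sum is fixed, so
both are locally constant.

Nearby planes are parametrized by `v₀` linearly in the Plücker coordinates (`exists_frame`), so the
determinants are forms there and define Zariski open sets. -/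

@[elab_as_elim]
theorem polyFun_induction {p : (f : V → k) → f ∈ polyFun k V → Prop}
    (hdual : ∀ ξ : Module.Dual k V, p ξ (Algebra.subset_adjoin ⟨ξ, rfl⟩))
    (hconst : ∀ c : k, p (fun _ => c) ((polyFun k V).algebraMap_mem c))
    (hadd : ∀ f g hf hg, p f hf → p g hg → p (f + g) (add_mem hf hg))
    (hmul : ∀ f g hf hg, p f hf → p g hg → p (f * g) (mul_mem hf hg))
    {f : V → k} (hf : f ∈ polyFun k V) : p f hf := by
  induction hf using Algebra.adjoin_induction with
  | mem x hx => obtain ⟨ξ, rfl⟩ := hx; exact hdual ξ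
  | algebraMap r => exact hconst r
  | add x y hx hy h1 h2 => exact hadd _ _ hx hy h1 h2
  | mul x y hx hy h1 h2 => exact hmul _ _ hx hy h1 h2

theorem dual_mem_polyFun (ξ : Module.Dual k V) : (ξ : V → k) ∈ polyFun k V :=
  Algebra.subset_adjoin ⟨ξ, rfl⟩

theorem const_mem_polyFun (c : k) : (fun _ => c : V → k) ∈ polyFun k V :=
  (polyFun k V).algebraMap_mem c

theorem comp_mem_polyFun {f : V → k} (hf : f ∈ polyFun k V) (L : U →ₗ[k] V) :
    f ∘ L ∈ polyFun k U := by
  induction hf using polyFun_induction with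
  | hdual ξ => exact dual_mem_polyFun (ξ ∘ₗ L)
  | hconst c => exact const_mem_polyFun c
  | hadd f g _ _ h1 h2 => exact add_mem h1 h2
  | hmul f g _ _ h1 h2 => exact mul_mem h1 h2

theorem exists_polynomial_on_line {f : V → k} (hf : f ∈ polyFun k V) (x y : V) :
    ∃ P : Polynomial k, ∀ c : k, f (x + c • y) = P.eval c := by
  induction hf using polyFun_induction with
  | hdual ξ =>
    exact ⟨Polynomial.C (ξ x) + Polynomial.X * Polynomial.C (ξ y), fun c => by
      simp; ring⟩
  | hconst c => exact ⟨Polynomial.C c, fun _ => by simp⟩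
  | hadd f g _ _ h1 h2 =>
    obtain ⟨P, hP⟩ := h1
    obtain ⟨Q, hQ⟩ := h2
    exact ⟨P + Q, fun c => by simp [hP, hQ]⟩
  | hmul f g _ _ h1 h2 =>
    obtain ⟨P, hP⟩ := h1
    obtain ⟨Q, hQ⟩ := h2
    exact ⟨P * Q, fun c => by simp [hP, hQ]⟩

/-- On the line joining a point where `f ≠ 0` to one where `g ≠ 0`, both become nonzero polynomials
in one variable. -/
theorem eq_zero_or_eq_zero_of_mul_eq_zero [Infinite k] {f g : V → k} (hf : f ∈ polyFun k V)
    (hg : g ∈ polyFun k V) (h : f * g = 0) : f = 0 ∨ g = 0 := by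
  by_contra! hne
  obtain ⟨x, hx⟩ := Function.ne_iff.1 hne.1
  obtain ⟨y, hy⟩ := Function.ne_iff.1 hne.2
  obtain ⟨P, hP⟩ := exists_polynomial_on_line hf x (y - x)
  obtain ⟨Q, hQ⟩ := exists_polynomial_on_line hg x (y - x)
  have hPQ : P * Q = 0 := Polynomial.funext fun c => by
    rw [Polynomial.eval_mul, ← hP, ← hQ]
    simpa using congrFun h (x + c • (y - x))
  rcases mul_eq_zero.1 hPQ with h0 | h0
  · exact hx (by simpa [h0] using hP 0)
  · exact hy (by simpa [h0] using hQ 1)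

theorem eq_of_mul_eq_mul [Infinite k] {f g h : V → k} (hh : h ∈ polyFun k V)
    (hf : f ∈ polyFun k V) (hg : g ∈ polyFun k V) (h0 : h ≠ 0) (e : h * f = h * g) : f = g := by
  have := eq_zero_or_eq_zero_of_mul_eq_zero hh (sub_mem hf hg)
    (by rw [mul_sub, e, sub_self])
  exact sub_eq_zero.1 (this.resolve_left h0)

/-- Division of a polynomial function by a linear form with remainder independent of one
coordinate. -/
theorem exists_remainder {f : V → k} (hf : f ∈ polyFun k V) (ℓ : Module.Dual k V) (z : V) :
    ∃ q ∈ polyFun k V, ∀ x, f x = f (x - ℓ x • z) + ℓ x * q x := by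
  have hπ : ∀ {f : V → k}, f ∈ polyFun k V → (fun x => f (x - ℓ x • z)) ∈ polyFun k V :=
    fun hf => comp_mem_polyFun hf (LinearMap.id - ℓ.smulRight z)
  induction hf using polyFun_induction with
  | hdual ξ => exact ⟨_, const_mem_polyFun (ξ z), fun x => by simp⟩
  | hconst c => exact ⟨0, zero_mem _, fun x => by simp⟩
  | hadd f g _ _ h1 h2 =>
    obtain ⟨P, hP, hP'⟩ := h1
    obtain ⟨Q, hQ, hQ'⟩ := h2
    refine ⟨P + Q, add_mem hP hQ, fun x => ?_⟩
    simp only [Pi.add_apply]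
    rw [hP' x, hQ' x]
    ring
  | hmul f g hf hg h1 h2 =>
    obtain ⟨P, hP, hP'⟩ := h1
    obtain ⟨Q, hQ, hQ'⟩ := h2
    -- With `f'`, `g'` the remainders, `f g - f' g' = (f - f') g + f' (g - g')`.
    refine ⟨P * g + (fun x => f (x - ℓ x • z)) * Q,
      add_mem (mul_mem hP hg) (mul_mem (hπ hf) hQ), fun x => ?_⟩
    simp only [Pi.add_apply, Pi.mul_apply]
    linear_combination g x * hP' x + f (x - ℓ x • z) * hQ' x

variable (k V) in
/-- The space of forms of degree `n` on `V`. -/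
def forms (n : ℕ) : Submodule k (V → k) where
  carrier := {f | f ∈ polyFun k V ∧ ∀ (c : k) (x : V), f (c • x) = c ^ n * f x}
  add_mem' := fun ⟨h1, h2⟩ ⟨h3, h4⟩ => ⟨add_mem h1 h3, fun c x => by
    simp only [Pi.add_apply, h2, h4, mul_add]⟩
  zero_mem' := ⟨zero_mem _, fun c x => by simp⟩
  smul_mem' := fun a f ⟨h1, h2⟩ => ⟨Subalgebra.smul_mem _ h1 a, fun c x => by
    simp only [Pi.smul_apply, h2, smul_eq_mul]; ring⟩

theorem coe_mem_forms {n : ℕ} {f : polyFun k V} (hf : IsHomog n f) : (f : V → k) ∈ forms k V n :=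
  ⟨f.2, hf⟩

theorem mul_mem_forms {m n : ℕ} {f g : V → k} (hf : f ∈ forms k V m) (hg : g ∈ forms k V n) :
    f * g ∈ forms k V (m + n) :=
  ⟨mul_mem hf.1 hg.1, fun c x => by simp only [Pi.mul_apply, hf.2, hg.2]; ring⟩

theorem one_mem_forms : (1 : V → k) ∈ forms k V 0 := ⟨one_mem _, fun c x => by simp⟩

theorem pow_mem_forms {m : ℕ} {f : V → k} (hf : f ∈ forms k V m) (r : ℕ) :
    f ^ r ∈ forms k V (m * r) :=
  ⟨pow_mem hf.1 r, fun c x => by simp only [Pi.pow_apply, hf.2]; ring⟩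

theorem prod_mem_forms {ι : Type*} (s : Finset ι) {m : ι → ℕ} {f : ι → V → k}
    (hf : ∀ i ∈ s, f i ∈ forms k V (m i)) : ∏ i ∈ s, f i ∈ forms k V (∑ i ∈ s, m i) :=
  ⟨prod_mem fun i hi => (hf i hi).1, fun c x => by
    simp only [Finset.prod_apply]
    rw [Finset.prod_congr rfl fun i hi => (hf i hi).2 c x, Finset.prod_mul_distrib,
      Finset.prod_pow_eq_pow_sum]⟩

theorem dual_mem_forms (ξ : Module.Dual k V) : (ξ : V → k) ∈ forms k V 1 :=
  ⟨dual_mem_polyFun ξ, fun c x => by simp⟩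

theorem comp_mem_forms {n : ℕ} {f : V → k} (hf : f ∈ forms k V n) (L : U →ₗ[k] V) :
    f ∘ L ∈ forms k U n :=
  ⟨comp_mem_polyFun hf.1 L, fun c x => by simp [hf.2]⟩

theorem eq_const_of_mem_forms_zero {f : V → k} (hf : f ∈ forms k V 0) (x : V) : f x = f 0 := by
  simpa using (hf.2 0 x).symm

theorem mem_forms_of_mul [Infinite k] {n : ℕ} {ℓ : Module.Dual k V} {f : V → k}
    (hf : f ∈ polyFun k V) (h0 : ℓ ≠ 0) (h : ℓ * f ∈ forms k V (n + 1)) : f ∈ forms k V n := by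
  have key : ∀ c : k, c ≠ 0 → ∀ x, f (c • x) = c ^ n * f x := by
    intro c hc
    refine congrFun (eq_of_mul_eq_mul (h := (ℓ : V → k)) (f := fun x => f (c • x))
      (g := fun x => c ^ n * f x) (dual_mem_polyFun ℓ)
      (comp_mem_polyFun hf (c • LinearMap.id)) (Subalgebra.smul_mem _ hf (c ^ n))
      (by simpa using h0) ?_)
    funext x
    have := h.2 c x
    simp only [Pi.mul_apply, map_smul, smul_eq_mul] at this ⊢
    exact mul_left_cancel₀ hc (by linear_combination this)
  -- The scalar `c = 0` cannot be cancelled; it is reached because both sides are polynomial in `c`.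
  refine ⟨hf, fun c x => ?_⟩
  obtain ⟨P, hP⟩ := exists_polynomial_on_line hf 0 x
  have hPe : Polynomial.X * P = Polynomial.X * (Polynomial.X ^ n * Polynomial.C (f x)) := by
    refine Polynomial.funext fun c => ?_
    rcases eq_or_ne c 0 with rfl | hc
    · simp
    · have := hP c
      rw [zero_add, key c hc] at this
      simp only [Polynomial.eval_mul, Polynomial.eval_X, Polynomial.eval_pow,
        Polynomial.eval_C, ← this]
  have := hP c
  rw [mul_left_cancel₀ Polynomial.X_ne_zero hPe] at this
  simpa only [zero_add, Polynomial.eval_mul, Polynomial.eval_X, Polynomial.eval_pow,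
    Polynomial.eval_C] using this

end PolyFun

/-! ### Binary forms -/

section Binary

variable {k : Type*} [Field k] {V : Type*} [AddCommGroup V] [Module k V]

/-- Here `ℓ` is the second coordinate for a basis `(y, z)`. The last clause says that projecting
along `z` lands on the line of `y`. -/
theorem exists_linear_form_vanishing_at (h2 : Module.finrank k V = 2) {y : V} (hy : y ≠ 0) :
    ∃ (ℓ : Module.Dual k V) (z : V), ℓ ≠ 0 ∧ ℓ y = 0 ∧ ∀ x, ∃ c : k, x - ℓ x • z = c • y := by
  obtain ⟨z, hz⟩ := exists_linearIndependent_pair_of_one_lt_finrank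
    (by omega : 1 < Module.finrank k V) hy
  let b := basisOfLinearIndependentOfCardEqFinrank hz (by simp [h2])
  have hb : ∀ i, b i = ![y, z] i := fun i => by simp [b]
  have hb0 : b 0 = y := by simp [hb]
  have hb1 : b 1 = z := by simp [hb]
  refine ⟨b.coord 1, z, fun h => ?_, ?_, fun x => ⟨b.coord 0 x, ?_⟩⟩
  · have := LinearMap.congr_fun h (b 1)
    simp at this
  · rw [← hb0]; simp
  · have := b.sum_repr x
    rw [Fin.sum_univ_two, hb0, hb1] at this
    rw [sub_eq_iff_eq_add]
    exact this.symm

theorem eq_smul_of_eq_zero {ℓ : Module.Dual k V} {y z : V}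
    (hz : ∀ x, ∃ c : k, x - ℓ x • z = c • y) {x : V} (hx : ℓ x = 0) : ∃ c : k, x = c • y := by
  simpa [hx] using hz x

/-- The remainder of `f` modulo `ℓ` is `f` evaluated on the line of `y`, where it vanishes. In
degree `0` no quotient of lower degree exists, but then `f` is constant, hence zero. -/
theorem exists_eq_mul_of_apply_eq_zero [Infinite k] {ℓ : Module.Dual k V} {y z : V} (hℓ : ℓ ≠ 0)
    (hz : ∀ x, ∃ c : k, x - ℓ x • z = c • y) {n : ℕ} {f : V → k} (hf : f ∈ forms k V n)
    (hfy : f y = 0) : f = 0 ∨ ∃ r, n = r + 1 ∧ ∃ q ∈ forms k V r, f = ℓ * q := by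
  obtain ⟨q, hq, hq'⟩ := exists_remainder hf.1 ℓ z
  have hfq : f = ℓ * q := by
    funext x
    obtain ⟨c, hc⟩ := hz x
    rw [hq' x, hc, hf.2, hfy]
    simp
  rcases n with _ | r
  · left
    funext x
    rw [eq_const_of_mem_forms_zero hf, ← eq_const_of_mem_forms_zero hf y, hfy, Pi.zero_apply]
  · exact Or.inr ⟨r, rfl, q, mem_forms_of_mul hq hℓ (hfq ▸ hf), hfq⟩

theorem exists_apply_eq_zero [IsAlgClosed k] (h2 : Module.finrank k V = 2) {n : ℕ} {f : V → k}
    (hf : f ∈ forms k V (n + 1)) : ∃ y ≠ 0, f y = 0 := by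
  have : Infinite k := IsAlgClosed.instInfinite
  have : Nontrivial V := Module.nontrivial_of_finrank_pos (R := k) (by omega)
  obtain ⟨w, hw⟩ := exists_ne (0 : V)
  obtain ⟨z, hz⟩ := exists_linearIndependent_pair_of_one_lt_finrank
    (by omega : 1 < Module.finrank k V) hw
  have hne := LinearIndependent.pair_iff.1 hz
  obtain ⟨P, hP⟩ := exists_polynomial_on_line hf.1 w z
  -- Degree `0` means a nonzero constant on the affine line `w + c • z`; the zero is then the point
  -- at infinity `z`. Otherwise, also when `P = 0`, there is a root.
  by_cases hd : P.degree = 0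
  · obtain ⟨a, ha⟩ : ∃ a, P = Polynomial.C a := ⟨_, Polynomial.eq_C_of_degree_eq_zero hd⟩
    obtain ⟨Q, hQ⟩ := exists_polynomial_on_line hf.1 z w
    refine ⟨z, fun h => one_ne_zero (hne 0 1 (by simp [h])).2, ?_⟩
    have hPQ : Polynomial.X * Q = Polynomial.X * (Polynomial.X ^ (n + 1) * Polynomial.C a) := by
      refine Polynomial.funext fun s => ?_
      rcases eq_or_ne s 0 with rfl | hs
      · simp
      · have h1 : z + s • w = s • (w + s⁻¹ • z) := by
          rw [smul_add, smul_smul, mul_inv_cancel₀ hs, one_smul, add_comm]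
        have h3 := hQ s
        rw [h1, hf.2, hP, ha, Polynomial.eval_C] at h3
        simp only [Polynomial.eval_mul, Polynomial.eval_X, Polynomial.eval_pow,
          Polynomial.eval_C, ← h3]
    have := hQ 0
    rw [mul_left_cancel₀ Polynomial.X_ne_zero hPQ] at this
    simpa using this
  · obtain ⟨c, hc⟩ := IsAlgClosed.exists_root P hd
    refine ⟨w + c • z, fun h => one_ne_zero (hne 1 c (by simpa using h)).1, ?_⟩
    rw [hP]
    exact hc

/-- The zeros of a nonzero binary form lie on finitely many lines. -/
theorem exists_finite_zeros [Infinite k] (h2 : Module.finrank k V = 2) {n : ℕ} {f : V → k}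
    (hf : f ∈ forms k V n) (h0 : f ≠ 0) :
    ∃ Z : Set V, Z.Finite ∧ (∀ y ∈ Z, y ≠ 0) ∧
      ∀ x, x ≠ 0 → f x = 0 → ∃ y ∈ Z, ∃ c : k, x = c • y := by
  induction n generalizing f with
  | zero =>
    refine ⟨∅, Set.finite_empty, by simp, fun x _ hx => (h0 ?_).elim⟩
    funext y
    rw [eq_const_of_mem_forms_zero hf, ← eq_const_of_mem_forms_zero hf x, hx, Pi.zero_apply]
  | succ n ih =>
    by_cases h : ∃ y ≠ 0, f y = 0
    · obtain ⟨y, hy, hfy⟩ := h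
      obtain ⟨ℓ, z, hℓ, -, hz⟩ := exists_linear_form_vanishing_at h2 hy
      obtain ⟨r, hr, q, hq, rfl⟩ := (exists_eq_mul_of_apply_eq_zero hℓ hz hf hfy).resolve_left h0
      obtain rfl : n = r := by omega
      obtain ⟨Z, hZ, hZ0, hZ'⟩ := ih hq (by rintro rfl; simp at h0)
      refine ⟨insert y Z, hZ.insert y, by simpa using ⟨hy, hZ0⟩, fun x hx hx0 => ?_⟩
      rcases mul_eq_zero.1 hx0 with h1 | h1
      · exact ⟨y, Set.mem_insert _ _, eq_smul_of_eq_zero hz h1⟩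
      · obtain ⟨y', hy', hc⟩ := hZ' x hx h1
        exact ⟨y', Set.mem_insert_of_mem _ hy', hc⟩
    · push Not at h
      exact ⟨∅, Set.finite_empty, by simp, fun x hx hx0 => (h x hx hx0).elim⟩

/-- Evaluation at `y` has one-dimensional target, and its kernel consists of multiples of `ℓ` by
forms of one degree less. -/
theorem fg_forms [Infinite k] (h2 : Module.finrank k V = 2) (n : ℕ) : (forms k V n).FG := by
  have : Nontrivial V := Module.nontrivial_of_finrank_pos (R := k) (by omega)
  obtain ⟨y, hy⟩ := exists_ne (0 : V)
  obtain ⟨ℓ, z, hℓ, -, hz⟩ := exists_linear_form_vanishing_at h2 hy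
  have key : ∀ n, (forms k V n ⊓ LinearMap.ker (LinearMap.proj (R := k) y : (V → k) →ₗ[k] k)).FG →
      (forms k V n).FG := fun n h =>
    Submodule.fg_of_fg_map_of_fg_inf_ker (LinearMap.proj (R := k) y) (IsNoetherian.noetherian _) h
  induction n with
  | zero =>
    apply key
    convert Submodule.fg_bot using 1
    refine (Submodule.eq_bot_iff _).2 fun f ⟨hf, hf0⟩ => ?_
    refine (exists_eq_mul_of_apply_eq_zero hℓ hz hf (by simpa using hf0)).resolve_right ?_
    rintro ⟨r, hr, -⟩
    omega
  | succ n ih =>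
    apply key
    have : forms k V (n + 1) ⊓ LinearMap.ker (LinearMap.proj (R := k) y : (V → k) →ₗ[k] k) ≤
        (forms k V n).map (LinearMap.mulLeft k (ℓ : V → k)) := by
      rintro f ⟨hf, hf0⟩
      rcases exists_eq_mul_of_apply_eq_zero hℓ hz hf (by simpa using hf0) with
        rfl | ⟨r, hr, q, hq, rfl⟩
      · exact zero_mem _
      · obtain rfl : n = r := by omega
        exact ⟨q, hq, rfl⟩
    have hfin : Module.Finite k ((forms k V n).map (LinearMap.mulLeft k (ℓ : V → k))) :=
      Module.Finite.iff_fg.2 (ih.map _)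
    exact Module.Finite.iff_fg.1 (Submodule.finiteDimensional_of_le this)

/-- If `u gⱼ = fⱼ w` for all `j` and the `fⱼ` have no common zero among the zeros of the binary
form `u`, then `u` divides `w`. -/
theorem exists_eq_mul_of_forall_mul_eq [IsAlgClosed k] (h2 : Module.finrank k V = 2)
    {ι : Type*} {f g : ι → V → k} (hf : ∀ j, f j ∈ polyFun k V) (hg : ∀ j, g j ∈ polyFun k V)
    {n l : ℕ} {u w : V → k} (hu : u ∈ forms k V n) (hw : w ∈ forms k V l) (h0 : u ≠ 0)
    (h : ∀ j, u * g j = f j * w) (hz : ∀ y, y ≠ 0 → u y = 0 → ∃ j, f j y ≠ 0) :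
    w = 0 ∨ ∃ r, l = n + r ∧ ∃ q ∈ forms k V r, w = u * q := by
  have : Infinite k := IsAlgClosed.instInfinite
  induction n generalizing l u w with
  | zero =>
    have hc : ∀ x, u x = u 0 := eq_const_of_mem_forms_zero hu
    have hu0 : u 0 ≠ 0 := fun h' => h0 (funext fun x => by rw [hc, h', Pi.zero_apply])
    refine Or.inr ⟨l, by simp, (u 0)⁻¹ • w, Submodule.smul_mem _ _ hw, ?_⟩
    funext x
    simp only [Pi.mul_apply, Pi.smul_apply, smul_eq_mul]
    rw [hc x, mul_inv_cancel_left₀ hu0]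
  | succ n ih =>
    obtain ⟨y, hy, huy⟩ := exists_apply_eq_zero h2 hu
    obtain ⟨ℓ, z, hℓ, hℓy, hℓz⟩ := exists_linear_form_vanishing_at h2 hy
    have hℓ' : (ℓ : V → k) ≠ 0 := by simpa using hℓ
    obtain ⟨r, hr, u', hu', rfl⟩ := (exists_eq_mul_of_apply_eq_zero hℓ hℓz hu huy).resolve_left h0
    obtain rfl : n = r := by omega
    -- At a zero `y` of `u` some `f j` survives, so `w` vanishes at `y` and the factor `ℓ` cancels
    -- from `u` and `w`.
    obtain ⟨j, hj⟩ := hz y hy huy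
    have hwy : w y = 0 := by
      have := congrFun (h j) y
      simpa [hℓy, hj] using this
    rcases exists_eq_mul_of_apply_eq_zero hℓ hℓz hw hwy with rfl | ⟨s, rfl, w', hw', rfl⟩
    · exact Or.inl rfl
    have h' : ∀ j, u' * g j = f j * w' := fun j =>
      eq_of_mul_eq_mul (dual_mem_polyFun ℓ) (mul_mem hu'.1 (hg j)) (mul_mem (hf j) hw'.1) hℓ'
        (by linear_combination h j)
    rcases ih hu' hw' (by rintro rfl; simp at h0) h' fun x hx hx0 => hz x hx (by simp [hx0]) with
      rfl | ⟨t, rfl, q, hq, rfl⟩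
    · exact Or.inl (by simp)
    · exact Or.inr ⟨t, by omega, q, hq, by ring⟩

/-- A tuple of binary forms that is proportional to a tuple without common zeros is a multiple
of the latter. -/
theorem exists_eq_mul_of_proportional [IsAlgClosed k] (h2 : Module.finrank k V = 2)
    {ι : Type*} {f g : ι → V → k} {d e : ℕ} (hf : ∀ j, f j ∈ forms k V d)
    (hg : ∀ j, g j ∈ forms k V e) (hz : ∀ y, y ≠ 0 → ∃ j, f j y ≠ 0)
    (h : ∀ i j, g i * f j = g j * f i) :
    g = 0 ∨ ∃ r, e = d + r ∧ ∃ c ∈ forms k V r, ∀ j, g j = c * f j := by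
  have : Infinite k := IsAlgClosed.instInfinite
  have : Nontrivial V := Module.nontrivial_of_finrank_pos (R := k) (by omega)
  obtain ⟨y, hy⟩ := exists_ne (0 : V)
  obtain ⟨i, hi⟩ := hz y hy
  have hi0 : f i ≠ 0 := fun h => hi (by simp [h])
  -- With `u = f i` and `w = g i`: the quotient of this one coordinate serves for all of them.
  rcases exists_eq_mul_of_forall_mul_eq h2 (fun j => (hf j).1) (fun j => (hg j).1) (hf i) (hg i)
    hi0 (fun j => by rw [mul_comm, h, mul_comm]) (fun x hx _ => hz x hx) with
    h0 | ⟨r, hr, c, hc, hgc⟩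
  · left
    funext j
    refine (eq_zero_or_eq_zero_of_mul_eq_zero (hg j).1 (hf i).1 ?_).resolve_right hi0
    rw [h, h0, zero_mul]
  · refine Or.inr ⟨r, hr, c, hc, fun j => ?_⟩
    refine eq_of_mul_eq_mul (hf i).1 (hg j).1 (mul_mem hc.1 (hf j).1) hi0 ?_
    rw [mul_comm, h, hgc, mul_assoc]

/-- A polynomial function on a plane without zeros outside the origin is a unit. -/
theorem isUnit_of_forall_ne_zero [IsAlgClosed k] (h2 : Module.finrank k V = 2) {q : polyFun k V}
    (hq : ∀ x, x ≠ 0 → (q : V → k) x ≠ 0) : IsUnit q := by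
  have : Infinite k := IsAlgClosed.instInfinite
  have : Nontrivial V := Module.nontrivial_of_finrank_pos (R := k) (by omega)
  -- The line through two independent vectors misses the origin, so `q` has no zero on it and is
  -- constant there.
  have hline : ∀ x y : V, LinearIndependent k ![x, y] → (q : V → k) x = (q : V → k) y := by
    intro x y hxy
    have hne := LinearIndependent.pair_iff.1 hxy
    obtain ⟨P, hP⟩ := exists_polynomial_on_line q.2 x (y - x)
    have hd : P.degree = 0 := by
      by_contra hd
      obtain ⟨c, hc⟩ := IsAlgClosed.exists_root P hd
      refine hq (x + c • (y - x)) (fun h => ?_) ((hP c).trans hc)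
      have := hne (1 - c) c (by rw [← h]; module)
      rw [this.2] at this
      simp at this
    rw [Polynomial.eq_C_of_degree_eq_zero hd] at hP
    have h0 := hP 0
    have h1 := hP 1
    simp only [Polynomial.eval_C, zero_smul, add_zero, one_smul, add_sub_cancel] at h0 h1
    rw [h0, h1]
  obtain ⟨w, hw⟩ := exists_ne (0 : V)
  obtain ⟨z, hz⟩ := exists_linearIndependent_pair_of_one_lt_finrank
    (by omega : 1 < Module.finrank k V) hw
  have hconst : ∀ x, x ≠ 0 → (q : V → k) x = (q : V → k) w := by
    intro x hx
    by_cases hxw : LinearIndependent k ![x, w]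
    · exact hline x w hxw
    · have hxz : LinearIndependent k ![x, z] := by
        rw [LinearIndependent.pair_iff' hx] at hxw ⊢
        push Not at hxw
        obtain ⟨a, rfl⟩ := hxw
        intro b hb
        have ha : a ≠ 0 := by rintro rfl; simp at hw
        rw [LinearIndependent.pair_iff' hw] at hz
        exact hz (b * a⁻¹) (by rw [smul_smul, mul_assoc, inv_mul_cancel₀ ha, mul_one, hb])
      rw [hline x z hxz, hline w z hz]
  have h0 : (q : V → k) 0 = (q : V → k) w := by
    obtain ⟨P, hP⟩ := exists_polynomial_on_line q.2 0 w
    have hPC : Polynomial.X * P = Polynomial.X * Polynomial.C ((q : V → k) w) := by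
      refine Polynomial.funext fun s => ?_
      rcases eq_or_ne s 0 with rfl | hs
      · simp
      · have := hP s
        rw [zero_add, hconst _ (smul_ne_zero hs hw)] at this
        simp only [Polynomial.eval_mul, Polynomial.eval_X, Polynomial.eval_C, ← this]
    have := hP 0
    rw [mul_left_cancel₀ Polynomial.X_ne_zero hPC] at this
    simpa using this
  have : q = algebraMap k (polyFun k V) ((q : V → k) w) := by
    apply Subtype.ext
    funext x
    rcases eq_or_ne x 0 with rfl | hx
    · exact h0
    · exact hconst x hx
  rw [this]
  exact (isUnit_iff_ne_zero.2 (hq w hw)).map _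

end Binary

/-! ### Defining systems of morphisms -/

section Parallel

variable {k : Type*} [Field k] {ι : Type*}

/-- The vector `a` lies on the line `q`. -/
def IsParallel (a : ι → k) (q : ℙ k (ι → k)) : Prop :=
  ∀ i j, a i * q.rep j = a j * q.rep i

theorem isParallel_mk_iff {a b : ι → k} (hb : b ≠ 0) :
    IsParallel a (Projectivization.mk k b hb) ↔ ∀ i j, a i * b j = a j * b i := by
  obtain ⟨c, hc⟩ := Projectivization.exists_smul_eq_mk_rep k b hb
  refine forall_congr' fun i => forall_congr' fun j => ?_
  rw [← hc]
  simp only [Pi.smul_apply, Units.smul_def, smul_eq_mul]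
  constructor <;> intro h
  · exact mul_left_cancel₀ c.ne_zero (by linear_combination h)
  · linear_combination (c : k) * h

theorem IsParallel.eq_mk {a : ι → k} {q : ℙ k (ι → k)} (h : IsParallel a q) (ha : a ≠ 0) :
    q = Projectivization.mk k a ha := by
  rw [← q.mk_rep, Projectivization.mk_eq_mk_iff']
  obtain ⟨i, hi⟩ := Function.ne_iff.1 ha
  refine ⟨q.rep i / a i, funext fun j => ?_⟩
  have hi : a i ≠ 0 := hi
  simp only [Pi.smul_apply, smul_eq_mul]
  rw [div_mul_eq_mul_div, div_eq_iff hi]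
  linear_combination - h i j

theorem IsParallel.mul_eq_mul {a b : ι → k} {q : ℙ k (ι → k)} (ha : IsParallel a q)
    (hb : IsParallel b q) (hb0 : b ≠ 0) (i j : ι) : a i * b j = a j * b i := by
  rw [hb.eq_mk hb0, isParallel_mk_iff] at ha
  exact ha i j

theorem IsParallel.of_mul_eq_mul {a b : ι → k} {q : ℙ k (ι → k)}
    (hb : IsParallel b q) (hb0 : b ≠ 0) (h : ∀ i j, a i * b j = a j * b i) : IsParallel a q := by
  rw [hb.eq_mk hb0, isParallel_mk_iff]
  exact h

end Parallel

/-! ### Existence and uniqueness of defining systems on a plane -/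

section Systems

variable {k : Type*} [Field k] {V : Type*} [AddCommGroup V] [Module k V] {ι : Type*}

/-- On the subset `Y`, the map `φ` is locally given by tuples of forms. -/
def LocallyGivenByForms (φ : ℙ k V → ℙ k (ι → k)) (Y : Set (ℙ k V)) : Prop :=
  ∀ (y : V) (hy : y ≠ 0), Projectivization.mk k y hy ∈ Y →
    ∃ (e : ℕ) (F : ι → V → k) (r : ℕ) (h : V → k), (∀ i, F i ∈ forms k V e) ∧ h ∈ forms k V r ∧
      h y ≠ 0 ∧ ∀ (x : V) (hx : x ≠ 0), Projectivization.mk k x hx ∈ Y → h x ≠ 0 →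
        (fun i => F i x) ≠ 0 ∧ IsParallel (fun i => F i x) (φ (Projectivization.mk k x hx))

/-- A system of forms of degree `d` without common zeros defining `ψ`. -/
def IsDefiningSystem (ψ : ℙ k V → ℙ k (ι → k)) (d : ℕ) (f : ι → V → k) : Prop :=
  (∀ i, f i ∈ forms k V d) ∧ ∀ (x : V) (hx : x ≠ 0),
    (fun i => f i x) ≠ 0 ∧ IsParallel (fun i => f i x) (ψ (Projectivization.mk k x hx))

theorem restrictProj_mk {T : Type*} (φ : ℙ k V → T) (W : Submodule k V) {x : W} (hx : x ≠ 0) :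
    restrictProj φ W (Projectivization.mk k x hx) =
      φ (Projectivization.mk k (x : V) (by simpa using hx)) := by
  simp [restrictProj, Projectivization.map_mk]

theorem LocallyGivenByForms.restrict {φ : ℙ k V → ℙ k (ι → k)} {Y : Set (ℙ k V)}
    (hφ : LocallyGivenByForms φ Y) {W : Submodule k V}
    (hW : ∀ (x : V) (hx : x ≠ 0), x ∈ W → Projectivization.mk k x hx ∈ Y) :
    LocallyGivenByForms (restrictProj φ W) Set.univ := by
  intro y hy _
  obtain ⟨e, F, r, h, hF, hh, hhy, H⟩ := hφ y (by simpa using hy) (hW _ _ y.2)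
  refine ⟨e, fun i => F i ∘ W.subtype, r, h ∘ W.subtype, fun i => comp_mem_forms (hF i) _,
    comp_mem_forms hh _, hhy, fun x hx _ hhx => ?_⟩
  rw [restrictProj_mk]
  exact H x (by simpa using hx) (hW _ _ x.2) hhx

theorem mul_eq_mul_of_isParallel [Infinite k] [Nontrivial V] {ψ : ℙ k V → ℙ k (ι → k)}
    {F G : ι → V → k} (hF : ∀ i, F i ∈ polyFun k V) (hG : ∀ i, G i ∈ polyFun k V)
    {h : V → k} (hh : h ∈ polyFun k V) (h0 : h ≠ 0)
    (H : ∀ (x : V) (hx : x ≠ 0), h x ≠ 0 → (fun i => F i x) ≠ 0 ∧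
      IsParallel (fun i => F i x) (ψ (Projectivization.mk k x hx)) ∧
      IsParallel (fun i => G i x) (ψ (Projectivization.mk k x hx))) (i j : ι) :
    G i * F j = G j * F i := by
  -- The factor `ξ` removes the origin, which is not a point of the projective space.
  obtain ⟨ξ, hξ⟩ := exists_ne (0 : Module.Dual k V)
  have hne : h * ξ ≠ 0 := by
    intro hc
    rcases eq_zero_or_eq_zero_of_mul_eq_zero hh (dual_mem_polyFun ξ) hc with hc | hc
    · exact h0 hc
    · exact hξ (by simpa using hc)
  refine eq_of_mul_eq_mul (mul_mem hh (dual_mem_polyFun ξ)) (mul_mem (hG i) (hF j))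
    (mul_mem (hG j) (hF i)) hne ?_
  funext x
  by_cases hx : x = 0
  · simp [hx]
  by_cases h1 : h x = 0
  · simp [h1]
  obtain ⟨h2, h3, h4⟩ := H x hx h1
  simp only [Pi.mul_apply, h4.mul_eq_mul h3 h2 i j]

/-- A tuple of polynomial functions that is proportional to `ψ` on a nonempty open set is
proportional to `ψ` everywhere. -/
theorem LocallyGivenByForms.isParallel_of_ne_zero [Infinite k] {ψ : ℙ k V → ℙ k (ι → k)}
    (hψ : LocallyGivenByForms ψ Set.univ) {G : ι → V → k} (hG : ∀ i, G i ∈ polyFun k V)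
    {h : V → k} (hh : h ∈ polyFun k V) (h0 : h ≠ 0)
    (H : ∀ (x : V) (hx : x ≠ 0), h x ≠ 0 →
      IsParallel (fun i => G i x) (ψ (Projectivization.mk k x hx))) (y : V) (hy : y ≠ 0) :
    IsParallel (fun i => G i y) (ψ (Projectivization.mk k y hy)) := by
  obtain ⟨e, F, r, h', hF, hh', hhy, H'⟩ := hψ y hy trivial
  have : Nontrivial V := ⟨y, 0, hy⟩
  have hne : h * h' ≠ 0 := by
    intro hc
    rcases eq_zero_or_eq_zero_of_mul_eq_zero hh hh'.1 hc with hc | hc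
    · exact h0 hc
    · exact hhy (congrFun hc y)
  have hmul := mul_eq_mul_of_isParallel (fun i => (hF i).1) hG (mul_mem hh hh'.1) hne
    fun x hx hhx => ⟨(H' x hx trivial (right_ne_zero_of_mul hhx)).1,
      (H' x hx trivial (right_ne_zero_of_mul hhx)).2, H x hx (left_ne_zero_of_mul hhx)⟩
  exact (H' y hy trivial hhy).2.of_mul_eq_mul (H' y hy trivial hhy).1
    fun i j => congrFun (hmul i j) y

/-- A nonzero tuple of minimal degree proportional to `ψ` has no common zero: otherwise a linear
form could be divided out. -/
theorem LocallyGivenByForms.exists_isDefiningSystem [Infinite k] (h2 : Module.finrank k V = 2)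
    {ψ : ℙ k V → ℙ k (ι → k)} (hψ : LocallyGivenByForms ψ Set.univ) :
    ∃ d f, IsDefiningSystem ψ d f := by
  classical
  have : Nontrivial V := Module.nontrivial_of_finrank_pos (R := k) (by omega)
  have hex : ∃ e, ∃ f : ι → V → k, (∀ i, f i ∈ forms k V e) ∧ f ≠ 0 ∧
      ∀ (x : V) (hx : x ≠ 0), IsParallel (fun i => f i x) (ψ (Projectivization.mk k x hx)) := by
    obtain ⟨y, hy⟩ := exists_ne (0 : V)
    obtain ⟨e, F, r, h, hF, hh, hhy, H⟩ := hψ y hy trivial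
    refine ⟨e, F, hF, ?_, hψ.isParallel_of_ne_zero (fun i => (hF i).1) hh.1 ?_
      fun x hx hhx => (H x hx trivial hhx).2⟩
    · rintro rfl
      exact (H y hy trivial hhy).1 rfl
    · rintro rfl
      exact hhy rfl
  obtain ⟨f, hf, hf0, hpar⟩ := Nat.find_spec hex
  refine ⟨Nat.find hex, f, hf, fun y hy => ⟨fun hfy => ?_, hpar y hy⟩⟩
  obtain ⟨ℓ, z, hℓ, -, hz⟩ := exists_linear_form_vanishing_at h2 hy
  have hdiv := fun i => exists_eq_mul_of_apply_eq_zero hℓ hz (hf i) (congrFun hfy i)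
  obtain ⟨r, hr⟩ : ∃ r, Nat.find hex = r + 1 := by
    by_contra! hc
    exact hf0 (funext fun i => (hdiv i).resolve_right fun ⟨r, hr, _⟩ => hc r hr)
  have hq : ∀ i, ∃ q ∈ forms k V r, f i = ℓ * q := by
    intro i
    rcases hdiv i with h0 | ⟨r', hr', h⟩
    · exact ⟨0, zero_mem _, by simp [h0]⟩
    · obtain rfl : r = r' := by omega
      exact h
  choose q hq hfq using hq
  refine Nat.find_min hex (m := r) (by omega) ⟨q, hq, ?_, ?_⟩
  · rintro rfl
    exact hf0 (funext fun i => by simp [hfq i])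
  · refine hψ.isParallel_of_ne_zero (fun i => (hq i).1) (dual_mem_polyFun ℓ) (by simpa using hℓ)
      fun x hx hℓx i j => mul_left_cancel₀ hℓx ?_
    have := hpar x hx i j
    simp only [hfq, Pi.mul_apply] at this
    linear_combination this

/-- A tuple of forms that is proportional to `ψ` on a nonempty open set is a multiple of a given
defining system. -/
theorem IsDefiningSystem.exists_eq_mul [IsAlgClosed k] (h2 : Module.finrank k V = 2)
    {ψ : ℙ k V → ℙ k (ι → k)} {d e : ℕ} {f g : ι → V → k} (hf : IsDefiningSystem ψ d f)
    (hg : ∀ i, g i ∈ forms k V e) {h : V → k} (hh : h ∈ polyFun k V) (h0 : h ≠ 0)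
    (H : ∀ (x : V) (hx : x ≠ 0), h x ≠ 0 →
      IsParallel (fun i => g i x) (ψ (Projectivization.mk k x hx))) :
    g = 0 ∨ ∃ r, e = d + r ∧ ∃ c ∈ forms k V r, ∀ j, g j = c * f j := by
  have : Infinite k := IsAlgClosed.instInfinite
  have : Nontrivial V := Module.nontrivial_of_finrank_pos (R := k) (by omega)
  exact exists_eq_mul_of_proportional h2 hf.1 hg
    (fun y hy => Function.ne_iff.1 (hf.2 y hy).1)
    (mul_eq_mul_of_isParallel (fun i => (hf.1 i).1) (fun i => (hg i).1) hh h0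
      fun x hx hhx => ⟨(hf.2 x hx).1, (hf.2 x hx).2, H x hx hhx⟩)

theorem IsDefiningSystem.ne_zero [Nontrivial V] {ψ : ℙ k V → ℙ k (ι → k)} {d : ℕ}
    {f : ι → V → k} (hf : IsDefiningSystem ψ d f) : f ≠ 0 := by
  rintro rfl
  obtain ⟨y, hy⟩ := exists_ne (0 : V)
  exact (hf.2 y hy).1 rfl

theorem IsDefiningSystem.degree_le [IsAlgClosed k] (h2 : Module.finrank k V = 2)
    {ψ : ℙ k V → ℙ k (ι → k)} {d e : ℕ} {f g : ι → V → k} (hf : IsDefiningSystem ψ d f)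
    (hg : IsDefiningSystem ψ e g) : d ≤ e := by
  have : Nontrivial V := Module.nontrivial_of_finrank_pos (R := k) (by omega)
  rcases hf.exists_eq_mul h2 hg.1 (one_mem _) one_ne_zero fun x hx _ => (hg.2 x hx).2 with
    h | ⟨r, rfl, -⟩
  · exact (hg.ne_zero h).elim
  · omega

/-- A common divisor of forms without common zeros vanishes nowhere outside the origin, hence is a
unit on a plane. Conversely, representing `ψ` at every point already excludes common zeros. -/
theorem hasReducedSystem_iff [IsAlgClosed k] (h2 : Module.finrank k V = 2) {m : ℕ}
    {ψ : ℙ k V → ℙ k (Fin (m + 1) → k)} {d : ℕ} :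
    HasReducedSystem ψ d ↔ ∃ f, IsDefiningSystem ψ d f := by
  constructor
  · rintro ⟨f, hf, -, h⟩
    refine ⟨fun i => f i, fun i => coe_mem_forms (hf i), fun x hx => ?_⟩
    obtain ⟨h0, hψ⟩ := h x hx
    refine ⟨h0, ?_⟩
    rw [hψ, isParallel_mk_iff]
    exact fun i j => mul_comm _ _
  · rintro ⟨f, hf, h⟩
    refine ⟨fun i => ⟨f i, (hf i).1⟩, fun i => (hf i).2, fun q hq => ?_, fun x hx =>
      ⟨(h x hx).1, (h x hx).2.eq_mk _⟩⟩
    refine isUnit_of_forall_ne_zero h2 fun x hx hqx => (h x hx).1 (funext fun i => ?_)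
    obtain ⟨r, hr⟩ := hq i
    have := congrFun (congrArg Subtype.val hr) x
    simpa [hqx] using this

/-- Existence and mutual divisibility make the set of degrees a singleton, so the `sInf` in
`projDegree` is attained. -/
theorem hasReducedSystem_iff_eq_projDegree [IsAlgClosed k] (h2 : Module.finrank k V = 2) {m : ℕ}
    {ψ : ℙ k V → ℙ k (Fin (m + 1) → k)} (hψ : LocallyGivenByForms ψ Set.univ) (d : ℕ) :
    HasReducedSystem ψ d ↔ d = projDegree ψ := by
  have : Infinite k := IsAlgClosed.instInfinite
  obtain ⟨e, f, hf⟩ := hψ.exists_isDefiningSystem h2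
  have key : ∀ d, HasReducedSystem ψ d ↔ d = e := fun d => by
    rw [hasReducedSystem_iff h2]
    constructor
    · rintro ⟨g, hg⟩
      exact le_antisymm (hg.degree_le h2 hf) (hf.degree_le h2 hg)
    · rintro rfl
      exact ⟨f, hf⟩
  have : {d | HasReducedSystem ψ d} = {e} := Set.ext key
  rw [key, projDegree, this, csInf_singleton]

end Systems

/-! ### Morphisms are locally given by forms -/

section Morphisms

variable {k : Type*} [Field k] {V : Type*} [AddCommGroup V] [Module k V]

theorem apply_rep_ne_zero_iff {n : ℕ} {f : V → k} (hf : f ∈ forms k V n) {x : V} (hx : x ≠ 0) :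
    f (Projectivization.mk k x hx).rep ≠ 0 ↔ f x ≠ 0 := by
  obtain ⟨c, hc⟩ := Projectivization.exists_smul_eq_mk_rep k x hx
  rw [← hc, Units.smul_def, hf.2]
  simp

theorem isOpen_setOf_apply_rep_ne_zero {n : ℕ} {f : V → k} (hf : f ∈ forms k V n) :
    IsOpen {ℓ : ℙ k V | f ℓ.rep ≠ 0} :=
  TopologicalSpace.isOpen_generateFrom_of_mem ⟨n, ⟨f, hf.1⟩, hf.2, rfl⟩

/-- Products of forms are forms, so the generating open sets are a basis. -/
theorem exists_form_of_isOpen {O : Set (ℙ k V)} (hO : IsOpen O) {y : ℙ k V} (hy : y ∈ O) :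
    ∃ (n : ℕ) (f : V → k), f ∈ forms k V n ∧ f y.rep ≠ 0 ∧ ∀ z : ℙ k V, f z.rep ≠ 0 → z ∈ O := by
  induction hO with
  | basic U hU =>
    obtain ⟨d, f, hf, rfl⟩ := hU
    exact ⟨d, f, coe_mem_forms hf, hy, fun z hz => hz⟩
  | univ => exact ⟨0, 1, one_mem_forms, one_ne_zero, fun _ _ => trivial⟩
  | inter s t _ _ hs ht =>
    obtain ⟨m, f, hf, hfy, hf'⟩ := hs hy.1
    obtain ⟨n, g, hg, hgy, hg'⟩ := ht hy.2
    exact ⟨m + n, f * g, mul_mem_forms hf hg, mul_ne_zero hfy hgy, fun z hz =>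
      ⟨hf' z (left_ne_zero_of_mul hz), hg' z (right_ne_zero_of_mul hz)⟩⟩
  | sUnion S _ ih =>
    obtain ⟨s, hs, hys⟩ := hy
    obtain ⟨n, f, hf, hfy, hf'⟩ := ih s hs hys
    exact ⟨n, f, hf, hfy, fun z hz => ⟨s, hs, hf' z hz⟩⟩

/-- Pulling back the coordinate ratios of a standard chart gives fractions `a j / b j`. Clearing
denominators gives forms of common degree `∑ i, d i`, since `a j` and `b j` have equal degree. -/
theorem IsMorphismOn.locallyGivenByForms {ι : Type*} [Fintype ι] {φ : ℙ k V → ℙ k (ι → k)}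
    {Y : Set (ℙ k V)} (hφ : IsMorphismOn φ Y) : LocallyGivenByForms φ Y := by
  classical
  intro y hy hyY
  set q := Projectivization.mk k y hy
  obtain ⟨i₀, hi₀⟩ := Function.ne_iff.1 (φ q).rep_nonzero
  set U : Set (ℙ k (ι → k)) := {z | z.rep i₀ ≠ 0}
  have hUo : IsOpen U :=
    isOpen_setOf_apply_rep_ne_zero (dual_mem_forms (LinearMap.proj i₀ : (ι → k) →ₗ[k] k))
  have hreg : ∀ j, IsRegularOn (fun z : ℙ k (ι → k) => z.rep j / z.rep i₀) U := fun j z hz =>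
    ⟨U, hUo, hz, 1, ⟨_, dual_mem_polyFun (LinearMap.proj j : (ι → k) →ₗ[k] k)⟩,
      ⟨_, dual_mem_polyFun (LinearMap.proj i₀ : (ι → k) →ₗ[k] k)⟩, (dual_mem_forms _).2,
      (dual_mem_forms _).2, fun w hw => ⟨hw.1, rfl⟩⟩
  have hyU : q ∈ Y ∩ φ ⁻¹' U := ⟨hyY, hi₀⟩
  choose O hO hyO d a b ha hb hab using fun j => hφ.2 U _ hUo (hreg j) q hyU
  obtain ⟨O', hO', hOU⟩ := (continuousOn_iff'.1 hφ.1) U hUo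
  have hyO' : q ∈ O' := (hOU.subset ⟨hi₀, hyY⟩).1
  obtain ⟨r, h, hh, hhy, hh'⟩ := exists_form_of_isOpen
    (hO'.inter (isOpen_iInter_of_finite hO)) ⟨hyO', Set.mem_iInter.2 hyO⟩
  have hF : ∀ i, (a i : V → k) * ∏ l ∈ Finset.univ.erase i, (b l : V → k) ∈
      forms k V (∑ i, d i) := by
    intro i
    rw [← Finset.add_sum_erase _ _ (Finset.mem_univ i)]
    exact mul_mem_forms (coe_mem_forms (ha i)) (prod_mem_forms _ fun l _ => coe_mem_forms (hb l))
  refine ⟨∑ i, d i, _, r, h, hF, hh, (apply_rep_ne_zero_iff hh hy).1 hhy, fun x hx hxY hhx => ?_⟩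
  set z := Projectivization.mk k x hx with hz
  have hzO := hh' z ((apply_rep_ne_zero_iff hh hx).2 hhx)
  have hzU : z ∈ Y ∩ φ ⁻¹' U := ⟨hxY, (hOU.superset ⟨hzO.1, hxY⟩).1⟩
  have hzi : (φ z).rep i₀ ≠ 0 := hzU.2
  have hq := fun j => hab j z ⟨Set.mem_iInter.1 hzO.2 j, hzU⟩
  obtain ⟨c, hc⟩ := Projectivization.exists_smul_eq_mk_rep k x hx
  have hcx : x = (c⁻¹ : kˣ) • z.rep := by rw [hz, ← hc, inv_smul_smul]
  set t := ∏ l, (b l : V → k) z.rep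
  have ht : t ≠ 0 := Finset.prod_ne_zero_iff.2 fun l _ => (hq l).1
  obtain ⟨s, hs, hval⟩ : ∃ s : k, s ≠ 0 ∧ ∀ i,
      ((a i : V → k) * ∏ l ∈ Finset.univ.erase i, (b l : V → k)) x = s * (φ z).rep i := by
    refine ⟨((c⁻¹ : kˣ) : k) ^ (∑ i, d i) * t / (φ z).rep i₀,
      div_ne_zero (mul_ne_zero (pow_ne_zero _ (Units.ne_zero _)) ht) hzi, fun i => ?_⟩
    have h1 : (φ z).rep i / (φ z).rep i₀ = (a i : V → k) z.rep / (b i : V → k) z.rep := (hq i).2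
    have h3 : t = (b i : V → k) z.rep * ∏ l ∈ Finset.univ.erase i, (b l : V → k) z.rep :=
      (Finset.mul_prod_erase _ _ (Finset.mem_univ i)).symm
    rw [hcx, Units.smul_def, (hF i).2, Pi.mul_apply, Finset.prod_apply, h3]
    have hbi := (hq i).1
    rw [div_eq_div_iff hzi hbi] at h1
    field_simp
    linear_combination (-∏ l ∈ Finset.univ.erase i, (b l : V → k) z.rep) * h1
  refine ⟨fun h0 => mul_ne_zero hs hzi ((hval i₀).symm.trans (congrFun h0 i₀)), fun i j => ?_⟩
  simp only [hval]
  ring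

end Morphisms

/-! ### Open conditions given by forms -/

section OpenConditions

variable {k : Type*} [Field k] {W : Type*} [AddCommGroup W] [Module k W]

theorem det_mem_forms {κ : Type*} [Fintype κ] [DecidableEq κ] {N : ℕ} {M : κ → κ → W → k}
    (hM : ∀ a b, M a b ∈ forms k W N) :
    (fun p => (Matrix.of fun a b => M a b p).det) ∈ forms k W (∑ _ : κ, N) := by
  have : (fun p => (Matrix.of fun a b => M a b p).det) =
      ∑ σ : Equiv.Perm κ, ((Equiv.Perm.sign σ : ℤ) : k) • ∏ i, M (σ i) i := by
    funext p
    simp [Matrix.det_apply']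
  rw [this]
  exact Submodule.sum_mem _ fun σ _ => Submodule.smul_mem _ _ (prod_mem_forms _ fun i _ => hM _ _)

/-- Joint injectivity of a family of linear functionals depending on `p` through forms of a fixed
degree is an open condition on `p`. -/
theorem exists_form_of_joint_injective {E : Type*} [AddCommGroup E] [Module k E]
    [FiniteDimensional k E] {J : Type*} {N : ℕ} (lam : J → W → Module.Dual k E)
    (hlam : ∀ j e, (fun p => lam j p e) ∈ forms k W N) {p₀ : W}
    (h0 : ∀ e, (∀ j, lam j p₀ e = 0) → e = 0) :
    ∃ n, ∃ H ∈ forms k W n, H p₀ ≠ 0 ∧ ∀ p, H p ≠ 0 → ∀ e, (∀ j, lam j p e = 0) → e = 0 := by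
  classical
  -- At `p₀` the functionals span the dual. A basis chosen among them, evaluated at variable `p` on
  -- a basis of `E`, gives the square matrix whose determinant is `H`.
  obtain ⟨κ, t, -, hspan, hli⟩ := exists_linearIndependent' k fun j => lam j p₀
  have htop : Submodule.span k (Set.range fun j => lam j p₀) = ⊤ := by
    rw [← Subspace.dualCoannihilator_dualAnnihilator_eq
      (W := Submodule.span k (Set.range fun j => lam j p₀))]
    have : (Submodule.span k (Set.range fun j => lam j p₀)).dualCoannihilator = ⊥ := by
      refine (Submodule.eq_bot_iff _).2 fun e he => h0 e fun j => ?_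
      exact (Submodule.mem_dualCoannihilator _ ).1 he _ (Submodule.subset_span ⟨j, rfl⟩)
    rw [this, Submodule.dualAnnihilator_bot]
  rw [htop] at hspan
  let B := Module.Basis.mk hli hspan.ge
  have : Fintype κ := FiniteDimensional.fintypeBasisIndex B
  have hcard : Fintype.card κ = Module.finrank k E := by
    rw [← Module.finrank_eq_card_basis B, Subspace.dual_finrank_eq]
  let b : Module.Basis κ k E :=
    (Module.finBasis k E).reindex (Fintype.equivFinOfCardEq hcard).symm
  have hmul : ∀ p (v : κ → k) a, ((Matrix.of fun a c => lam (t a) p (b c)).mulVec v) a =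
      lam (t a) p (∑ c, v c • b c) := by
    intro p v a
    simp [Matrix.mulVec, dotProduct, mul_comm]
  refine ⟨_, _, det_mem_forms (M := fun a c p => lam (t a) p (b c)) fun a c => hlam _ _,
    fun hdet => ?_, fun p hp e he => ?_⟩
  · obtain ⟨v, hv, hv0⟩ := Matrix.exists_mulVec_eq_zero_iff.2 hdet
    refine hv (funext fun c => ?_)
    have : ∑ c, v c • b c = 0 := by
      refine (Module.forall_dual_apply_eq_zero_iff k _).1 fun η => ?_
      have hη : η ∈ Submodule.span k (Set.range ((fun j => lam j p₀) ∘ t)) := hspan ▸ trivial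
      induction hη using Submodule.span_induction with
      | mem x hx =>
        obtain ⟨a, rfl⟩ := hx
        exact (hmul p₀ v a).symm.trans (congrFun hv0 a)
      | zero => rfl
      | add x y _ _ hx hy => simp only [LinearMap.add_apply, hx, hy, add_zero]
      | smul r x _ hx => simp only [LinearMap.smul_apply, hx, smul_zero]
    exact Fintype.linearIndependent_iff.1 b.linearIndependent v this c
  · have := Matrix.eq_zero_of_mulVec_eq_zero (v := fun c => b.repr e c) hp (funext fun a => by
      rw [hmul, b.sum_repr, he, Pi.zero_apply])
    rw [← b.sum_repr e]
    exact Finset.sum_eq_zero fun c _ => by rw [congrFun this c, Pi.zero_apply, zero_smul]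

/-- Let the matrix of forms `M` factor along the plane `Λ p₀` as `c ⊗ f` with `f` without common
zeros. Then for `p` near `p₀` the degree of the second factor of any such factorization of `M`
along `Λ p` is at least the degree of `f`. -/
theorem exists_form_le_degree [IsAlgClosed k] {V g : Type*} [AddCommGroup V] [Module k V]
    [AddCommGroup g] [Module k g] (h2 : Module.finrank k V = 2) (Λ : W →ₗ[k] V →ₗ[k] g)
    {α ι : Type*} [Finite ι] {e : ℕ} {M : α → ι → g → k} (hM : ∀ a i, M a i ∈ forms k g e)
    {p₀ : W} {d : ℕ} {c : α → V → k} {f : ι → V → k} (hc : ∀ a, c a ∈ polyFun k V)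
    (hc0 : c ≠ 0) (hf : ∀ i, f i ∈ forms k V d) (hz : ∀ y, y ≠ 0 → ∃ i, f i y ≠ 0)
    (hMcf : ∀ a i, M a i ∘ Λ p₀ = c a * f i) :
    ∃ n, ∃ H ∈ forms k W n, H p₀ ≠ 0 ∧ ∀ p, H p ≠ 0 → ∀ (d' : ℕ) (c' : α → V → k)
      (f' : ι → V → k), (∀ i, f' i ∈ forms k V d') → f' ≠ 0 →
      (∀ a i, M a i ∘ Λ p = c' a * f' i) → d ≤ d' := by
  have : Infinite k := IsAlgClosed.instInfinite
  have : Nontrivial V := Module.nontrivial_of_finrank_pos (R := k) (by omega)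
  -- From here on `f` has degree `d + 1`, and the test tuples have degree `d`.
  rcases d with _ | d
  · exact ⟨0, 1, one_mem_forms, one_ne_zero, fun _ _ _ _ _ _ _ _ => Nat.zero_le _⟩
  have : Module.Finite k (forms k V d) := Module.Finite.iff_fg.2 (fg_forms h2 d)
  let ev (i : ι) (x : V) : (ι → forms k V d) →ₗ[k] k :=
    LinearMap.proj (R := k) (φ := fun _ : V => k) x ∘ₗ (forms k V d).subtype ∘ₗ LinearMap.proj i
  -- The equations say that the tuple `A` is proportional to each row of `M` along `Λ p`.
  let lam (j : α × ι × ι × V) (p : W) : Module.Dual k (ι → forms k V d) :=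
    M j.1 j.2.2.1 (Λ p j.2.2.2) • ev j.2.1 j.2.2.2 - M j.1 j.2.1 (Λ p j.2.2.2) • ev j.2.2.1 j.2.2.2
  have hlam_apply : ∀ a i j x p A, lam (a, i, j, x) p A =
      M a j (Λ p x) * (A i : V → k) x - M a i (Λ p x) * (A j : V → k) x := fun _ _ _ _ _ _ => rfl
  have hlam : ∀ j A, (fun p => lam j p A) ∈ forms k W e := by
    rintro ⟨a, i, j, x⟩ A
    have h := fun i => comp_mem_forms (hM a i) (Λ.flip x)
    convert sub_mem (Submodule.smul_mem _ ((A i : V → k) x) (h j))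
      (Submodule.smul_mem _ ((A j : V → k) x) (h i)) using 1
    funext p
    simp [hlam_apply, mul_comm]
  obtain ⟨n, H, hH, hHp, hH'⟩ := exists_form_of_joint_injective lam hlam (p₀ := p₀) (by
    intro A hA
    obtain ⟨a, ha⟩ := Function.ne_iff.1 hc0
    have hprop : ∀ i j, (A i : V → k) * f j = (A j : V → k) * f i := by
      intro i j
      refine eq_of_mul_eq_mul (hc a) (mul_mem (A i).2.1 (hf j).1) (mul_mem (A j).2.1 (hf i).1) ha ?_
      funext x
      have h1 := congrFun (hMcf a i) x
      have h3 := congrFun (hMcf a j) x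
      have h4 := hA (a, i, j, x)
      rw [hlam_apply] at h4
      simp only [Function.comp_apply, Pi.mul_apply] at h1 h3 ⊢
      rw [h1, h3] at h4
      linear_combination h4
    -- A nonzero solution would be a multiple of `f`, whose degree is too large.
    rcases exists_eq_mul_of_proportional h2 hf (fun i => (A i).2) hz hprop with h | ⟨r, hr, -⟩
    · exact funext fun i => Subtype.ext (congrFun h i)
    · omega)
  refine ⟨n, H, hH, hHp, fun p hp d' c' f' hf' hf0 hM' => ?_⟩
  by_contra! hlt
  obtain ⟨ξ, hξ⟩ := exists_ne (0 : Module.Dual k V)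
  have hξ' : (ξ : V → k) ≠ 0 := by simpa using hξ
  obtain ⟨s, rfl⟩ : ∃ s, d = s + d' := ⟨d - d', by omega⟩
  have hq : (ξ : V → k) ^ s ∈ forms k V s := by
    simpa using pow_mem_forms (dual_mem_forms ξ) s
  have hq0 : (ξ : V → k) ^ s ≠ 0 := by
    obtain ⟨x, hx⟩ := Function.ne_iff.1 hξ'
    exact Function.ne_iff.2 ⟨x, pow_ne_zero _ hx⟩
  have := hH' p hp (fun i => ⟨(ξ : V → k) ^ s * f' i, mul_mem_forms hq (hf' i)⟩) (by
    rintro ⟨a, i, j, x⟩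
    have h1 := congrFun (hM' a i) x
    have h3 := congrFun (hM' a j) x
    simp only [Function.comp_apply, Pi.mul_apply] at h1 h3
    rw [hlam_apply, h1, h3]
    simp only [Pi.mul_apply]
    ring)
  refine hf0 (funext fun i => ?_)
  exact (eq_zero_or_eq_zero_of_mul_eq_zero hq.1 (hf' i).1
    (congrArg Subtype.val (congrFun this i))).resolve_left hq0

end OpenConditions

/-! ### Local frames on the Grassmannian of planes -/

section Grassmannian

variable {k : Type*} [Field k] {g : Type*} [AddCommGroup g] [Module k g]

/-- Contraction of a bivector with a family of linear forms. -/
noncomputable def contraction {V : Type*} [AddCommGroup V] [Module k V]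
    (ξ : V →ₗ[k] Module.Dual k g) : ⋀[k]^2 g →ₗ[k] V →ₗ[k] g :=
  exteriorPower.alternatingMapLinearEquiv
    { toFun := fun b => (ξ.flip (b 1)).smulRight (b 0) - (ξ.flip (b 0)).smulRight (b 1)
      map_update_add' := by
        intro _ b i x y
        ext z
        fin_cases i <;> simp [add_smul, Function.update] <;> abel
      map_update_smul' := by
        intro _ b i c x
        ext z
        fin_cases i <;> simp [Function.update] <;> module
      map_eq_zero_of_eq' := by
        intro b i j hij hne
        ext z
        fin_cases i <;> fin_cases j <;> simp_all }

theorem contraction_ιMulti {V : Type*} [AddCommGroup V] [Module k V]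
    (ξ : V →ₗ[k] Module.Dual k g) (b : Fin 2 → g) (x : V) :
    contraction ξ (exteriorPower.ιMulti k 2 b) x = ξ x (b 1) • b 0 - ξ x (b 0) • b 1 := by
  rw [contraction, exteriorPower.alternatingMapLinearEquiv_apply_ιMulti]
  rfl

variable [FiniteDimensional k g]

theorem exists_plucker_rep_eq {r : ℕ} (v : Gr k g r) : ∃ c : k, c ≠ 0 ∧
    (plucker v).rep = c • exteriorPower.ιMulti k r fun i => (v.basis i : g) := by
  obtain ⟨c, hc⟩ := Projectivization.exists_smul_eq_mk_rep k
    (exteriorPower.ιMulti k r fun i => (v.basis i : g))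
    (ιMulti_ne_zero (v.basis.linearIndependent.map' v.space.subtype (Submodule.ker_subtype _)))
  exact ⟨c, c.ne_zero, hc.symm⟩

/-- With `π` a retraction onto `v₀` and `ξ x` the form dual to `x`, contracting `b₀ ∧ b₁` gives a
combination of `b₀` and `b₁`, hence a vector of `v`. On `v₀` it is, up to a scalar, the quarter turn
`x₁ b₀ - x₀ b₁`, which is injective in `x`. -/
theorem exists_frame (v₀ : Gr k g 2) : ∃ Λ : ⋀[k]^2 g →ₗ[k] v₀.space →ₗ[k] g,
    (∀ x, Λ (plucker v₀).rep x = 0 → x = 0) ∧ ∀ v x, Λ (plucker v).rep x ∈ v.space := by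
  classical
  obtain ⟨π, hπ⟩ := v₀.space.subtype.exists_leftInverse_of_injective (Submodule.ker_subtype _)
  refine ⟨contraction (π.dualMap ∘ₗ v₀.basis.toDual), fun x hx => ?_, fun v x => ?_⟩
  · obtain ⟨c, hc, hp⟩ := exists_plucker_rep_eq v₀
    rw [hp, map_smul, LinearMap.smul_apply, contraction_ιMulti, smul_eq_zero_iff_right hc] at hx
    have hπ' : ∀ y : v₀.space, π y = y := fun y => LinearMap.congr_fun hπ y
    simp only [LinearMap.comp_apply, LinearMap.dualMap_apply, hπ'] at hx
    have h3 := Fintype.linearIndependent_iff.1 v₀.basis.linearIndependent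
      ![v₀.basis.toDual x (v₀.basis 1), -v₀.basis.toDual x (v₀.basis 0)] (by
        rw [Fin.sum_univ_two]
        apply Subtype.ext
        simpa [sub_eq_add_neg] using hx)
    refine v₀.basis.toDual_injective (v₀.basis.ext fun i => ?_)
    have h4 := h3 0
    have h5 := h3 1
    fin_cases i
    · simpa using h5
    · simpa using h4
  · obtain ⟨c, hc, hp⟩ := exists_plucker_rep_eq v
    rw [hp, map_smul, LinearMap.smul_apply, contraction_ιMulti]
    exact Submodule.smul_mem _ _ (sub_mem (Submodule.smul_mem _ _ (v.basis 0).2)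
      (Submodule.smul_mem _ _ (v.basis 1).2))

theorem eventually_plucker_rep_ne_zero {r n : ℕ} {H : ⋀[k]^r g → k}
    (hH : H ∈ forms k (⋀[k]^r g) n) {v₀ : Gr k g r} (h0 : H (plucker v₀).rep ≠ 0) :
    ∀ᶠ v in nhds v₀, H (plucker v).rep ≠ 0 :=
  ((isOpen_setOf_apply_rep_ne_zero hH).preimage continuous_induced_dom).mem_nhds h0

end Grassmannian

/-! ### The degree is locally constant -/

section Family

variable {k : Type*} [Field k] {V : Type*} [AddCommGroup V] [Module k V] {ι : Type*}

/-- Finitely many local systems suffice for a plane; they may be chosen of the same degree. -/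
theorem LocallyGivenByForms.exists_finite_family [Infinite k] [FiniteDimensional k V]
    {φ : ℙ k V → ℙ k (ι → k)} {Y : Set (ℙ k V)} (hφ : LocallyGivenByForms φ Y)
    {W : Submodule k V} (h2 : Module.finrank k W = 2)
    (hW : ∀ (x : V) (hx : x ≠ 0), x ∈ W → Projectivization.mk k x hx ∈ Y) :
    ∃ (Z : Set W) (n : ℕ) (e : ℕ) (M : Z × Fin n → ι → V → k) (r : Z → ℕ) (h : Z → V → k),
      Z.Finite ∧ (∀ a i, M a i ∈ forms k V e) ∧ (∀ z, h z ∈ forms k V (r z)) ∧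
      (∀ z, h z (z : W) ≠ 0) ∧
      (∀ a (x : V) (hx : x ≠ 0), Projectivization.mk k x hx ∈ Y → h a.1 x ≠ 0 →
        IsParallel (fun i => M a i x) (φ (Projectivization.mk k x hx))) ∧
      ∀ y : W, y ≠ 0 → ∃ a i, M a i y ≠ 0 := by
  have : Nontrivial W := Module.nontrivial_of_finrank_pos (R := k) (by omega)
  obtain ⟨w, hw⟩ := exists_ne (0 : W)
  have hloc : ∀ y : W, y ≠ 0 → _ := fun y hy =>
    hφ y (by simpa using hy) (hW y (by simpa using hy) y.2)
  obtain ⟨e₁, F₁, r₁, h₁, hF₁, hh₁, hhw, H₁⟩ := hloc w hw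
  obtain ⟨Z, hZ, hZ0, hZ'⟩ := exists_finite_zeros h2 (comp_mem_forms hh₁ W.subtype)
    fun h => hhw (congrFun h w)
  -- The system at `w` must be the one whose denominator `h₁` produced `Z`; the clause `h = h₁`
  -- records this after `choose`.
  have hloc' : ∀ y : (insert w Z : Set W), ∃ (e : ℕ) (F : ι → V → k) (r : ℕ) (h : V → k),
      (∀ i, F i ∈ forms k V e) ∧ h ∈ forms k V r ∧ h (y : W) ≠ 0 ∧ (y = ⟨w, Set.mem_insert _ _⟩ →
        h = h₁) ∧ ∀ (x : V) (hx : x ≠ 0), Projectivization.mk k x hx ∈ Y → h x ≠ 0 →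
        (fun i => F i x) ≠ 0 ∧ IsParallel (fun i => F i x) (φ (Projectivization.mk k x hx)) := by
    rintro ⟨y, hy⟩
    by_cases hyw : y = w
    · subst hyw
      exact ⟨e₁, F₁, r₁, h₁, hF₁, hh₁, hhw, fun _ => rfl, H₁⟩
    · obtain ⟨e, F, r, h, hF, hh, hhy, H⟩ := hloc y (hZ0 y (hy.resolve_left hyw))
      exact ⟨e, F, r, h, hF, hh, hhy, fun h' => (hyw (congrArg Subtype.val h')).elim, H⟩
  choose e F r h hF hh hhy hhw' H using hloc'
  have : Finite (insert w Z : Set W) := (hZ.insert w).to_subtype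
  obtain ⟨E, hE⟩ : ∃ E, ∀ z, e z ≤ E := by
    obtain ⟨E, hE⟩ := (Set.finite_range e).bddAbove
    exact ⟨E, fun z => hE ⟨z, rfl⟩⟩
  -- Degrees are equalized by powers of every coordinate in turn; coordinates have no common zero
  -- off the origin, so none is created.
  let b := Module.finBasis k V
  have key : ∀ (z : (insert w Z : Set W)) (y : W), y ≠ 0 → (∃ i, F z i y ≠ 0) →
      ∃ (a : ↥(insert w Z : Set W) × Fin (Module.finrank k V)) (i : ι),
        (F a.1 i * (b.coord a.2 : V → k) ^ (E - e a.1)) y ≠ 0 := by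
    rintro z y hy ⟨i, hi⟩
    obtain ⟨l, hl⟩ : ∃ l, b.coord l y ≠ 0 := by
      by_contra! hc
      exact hy (Subtype.ext (b.forall_coord_eq_zero_iff.1 hc))
    exact ⟨(z, l), i, mul_ne_zero hi (pow_ne_zero _ hl)⟩
  refine ⟨insert w Z, Module.finrank k V, E,
    fun (a : ↥(insert w Z : Set W) × Fin (Module.finrank k V)) i =>
      F a.1 i * (b.coord a.2 : V → k) ^ (E - e a.1), r, h, hZ.insert w,
    fun a i => ?_, hh, hhy, fun a x hx hxY hhx i j => ?_, fun y hy => ?_⟩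
  · have := mul_mem_forms (hF a.1 i) (pow_mem_forms (dual_mem_forms (b.coord a.2)) (E - e a.1))
    rwa [one_mul, Nat.add_sub_cancel' (hE _)] at this
  · have := (H a.1 x hx hxY hhx).2 i j
    simp only [Pi.mul_apply, Pi.pow_apply]
    linear_combination (b.coord a.2 x) ^ (E - e a.1) * this
  · have hy' : (y : V) ≠ 0 := by simpa using hy
    by_cases h0 : h₁ y = 0
    · obtain ⟨z, hz, c, rfl⟩ := hZ' y hy h0
      have hz0 : (z : V) ≠ 0 := by simpa using hZ0 z hz
      obtain ⟨i, hi⟩ := Function.ne_iff.1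
        (H ⟨z, Set.mem_insert_of_mem _ hz⟩ z hz0 (hW _ hz0 z.2) (hhy ⟨z, _⟩)).1
      refine key ⟨z, Set.mem_insert_of_mem _ hz⟩ _ hy ⟨i, ?_⟩
      rw [Submodule.coe_smul, (hF _ i).2]
      exact mul_ne_zero (pow_ne_zero _ (left_ne_zero_of_smul hy)) hi
    · obtain ⟨i, hi⟩ := Function.ne_iff.1 (H ⟨w, Set.mem_insert _ _⟩ y hy' (hW _ hy' y.2)
        (by rwa [hhw' _ rfl])).1
      exact key _ y hy ⟨i, hi⟩

/-- A matrix of forms of the same degree whose rows are multiples of a defining system factors. -/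
theorem IsDefiningSystem.exists_factorization [IsAlgClosed k] (h2 : Module.finrank k V = 2)
    {ψ : ℙ k V → ℙ k (ι → k)} {d e : ℕ} {f : ι → V → k} (hf : IsDefiningSystem ψ d f)
    {α : Type*} {M : α → ι → V → k} (hM : ∀ a i, M a i ∈ forms k V e) {h : α → V → k}
    (hh : ∀ a, h a ∈ polyFun k V) (h0 : ∀ a, h a ≠ 0)
    (H : ∀ a (x : V) (hx : x ≠ 0), h a x ≠ 0 →
      IsParallel (fun i => M a i x) (ψ (Projectivization.mk k x hx))) (hM0 : M ≠ 0) :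
    ∃ r, e = d + r ∧ ∃ c : α → V → k, c ≠ 0 ∧ (∀ a, c a ∈ forms k V r) ∧
      ∀ a i, M a i = c a * f i := by
  have hrow := fun a => hf.exists_eq_mul h2 (hM a) (hh a) (h0 a) (H a)
  -- A nonzero row fixes the degree `r`; zero rows take `c = 0`.
  obtain ⟨a, ha⟩ := Function.ne_iff.1 hM0
  obtain ⟨r, hr, -⟩ := (hrow a).resolve_left ha
  refine ⟨r, hr, ?_⟩
  have hrow' : ∀ a, ∃ c ∈ forms k V r, ∀ i, M a i = c * f i := by
    intro a
    rcases hrow a with h | ⟨r', hr', h⟩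
    · exact ⟨0, zero_mem _, fun i => by simp [h]⟩
    · obtain rfl : r = r' := by omega
      exact h
  choose c hc hMc using hrow'
  refine ⟨c, ?_, hc, hMc⟩
  rintro rfl
  exact hM0 (funext fun a => funext fun i => by simp [hMc])

end Family

theorem Gr.finrank_space {k : Type*} [Field k] {V : Type*} [AddCommGroup V] [Module k V] {r : ℕ}
    (v : Gr k V r) : Module.finrank k v.space = r :=
  v.2

/-! ### Semicontinuity of both factors forces local constancy -/

section Main

variable {k : Type*} [Field k] [IsAlgClosed k] {g : Type*} [AddCommGroup g] [Module k g]
  [FiniteDimensional k g]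

theorem LocallyGivenByForms.eventually_degree_eq {ι : Type*} [Finite ι]
    {φ : ℙ k g → ℙ k (ι → k)} {Y : Set (ℙ k g)} (hφ : LocallyGivenByForms φ Y)
    {X : Set (Gr k g 2)}
    (hX : ∀ v ∈ X, ∀ (x : g) (hx : x ≠ 0), x ∈ v.space → Projectivization.mk k x hx ∈ Y)
    {v₀ : Gr k g 2} (hv₀ : v₀ ∈ X) {d₀ : ℕ} {f₀ : ι → v₀.space → k}
    (hf₀ : IsDefiningSystem (restrictProj φ v₀.space) d₀ f₀) :
    ∀ᶠ v in nhds v₀, v ∈ X → ∀ (d : ℕ) (f : ι → v.space → k),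
      IsDefiningSystem (restrictProj φ v.space) d f → d = d₀ := by
  have : Infinite k := IsAlgClosed.instInfinite
  obtain ⟨Z, n, e, M, r, h, hZ, hM, hh, hhz, hpar, hM0⟩ :=
    hφ.exists_finite_family v₀.finrank_space (hX v₀ hv₀)
  have : Finite Z := hZ.to_subtype
  obtain ⟨Λ, hΛ, hΛv⟩ := exists_frame v₀
  let L (v : Gr k g 2) : v₀.space →ₗ[k] v.space := (Λ (plucker v).rep).codRestrict v.space (hΛv v)
  have hL_surj : ∀ v : Gr k g 2, (∀ x, Λ (plucker v).rep x = 0 → x = 0) →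
      Function.Surjective (L v) := by
    intro v hv
    refine (LinearMap.injective_iff_surjective_of_finrank_eq_finrank
      (v₀.finrank_space.trans v.finrank_space.symm)).1
      ((injective_iff_map_eq_zero _).2 fun x hx => hv x (congrArg Subtype.val hx))
  -- the factorization of `M` on planes satisfying open conditions, pulled back to `v₀`
  have hfac : ∀ v ∈ X, (∀ x, Λ (plucker v).rep x = 0 → x = 0) →
      (∀ z, ∃ y : v.space, h z y ≠ 0) → (∃ a i, ∃ y : v.space, M a i y ≠ 0) →
      ∀ (d : ℕ) (f : ι → v.space → k), IsDefiningSystem (restrictProj φ v.space) d f →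
      ∃ s, e = d + s ∧ ∃ c : Z × Fin n → v₀.space → k, c ≠ 0 ∧ (∀ a, c a ∈ forms k v₀.space s) ∧
        (fun i => f i ∘ L v) ≠ 0 ∧ ∀ a i, M a i ∘ Λ (plucker v).rep = c a * (f i ∘ L v) := by
    intro v hv hinj hhv hMv d f hf
    have : Nontrivial v.space := Module.nontrivial_of_finrank_pos (R := k)
      (by simp [v.finrank_space])
    obtain ⟨s, hs, c, hc0, hc, hMc⟩ := hf.exists_factorization v.finrank_space
      (M := fun a i => M a i ∘ v.space.subtype) (h := fun a => h a.1 ∘ v.space.subtype)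
      (fun a i => comp_mem_forms (hM a i) _) (fun a => comp_mem_polyFun (hh a.1).1 _)
      (fun a h0 => by
        obtain ⟨y, hy⟩ := hhv a.1
        exact hy (congrFun h0 y))
      (fun a x hx hhx => by
        rw [restrictProj_mk]
        exact hpar a x (by simpa using hx) (hX v hv _ _ x.2) hhx)
      (fun h0 => by
        obtain ⟨a, i, y, hy⟩ := hMv
        exact hy (congrFun (congrFun (congrFun h0 a) i) y))
    refine ⟨s, hs, fun a => c a ∘ L v, fun h0 => hc0 (funext fun a => funext fun y => ?_),
      fun a => comp_mem_forms (hc a) _, fun h0 => hf.ne_zero (funext fun i => funext fun y => ?_),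
      fun a i => ?_⟩
    · obtain ⟨x, rfl⟩ := hL_surj v hinj y
      exact congrFun (congrFun h0 a) x
    · obtain ⟨x, rfl⟩ := hL_surj v hinj y
      exact congrFun (congrFun h0 i) x
    · funext x
      exact congrFun (hMc a i) (L v x)
  have hnt : Nontrivial v₀.space := Module.nontrivial_of_finrank_pos (R := k)
    (by simp [v₀.finrank_space])
  obtain ⟨y₀, hy₀⟩ := exists_ne (0 : v₀.space)
  obtain ⟨a₀, i₀, hMy₀⟩ := hM0 y₀ hy₀
  obtain ⟨s₀, hs₀, c₀, hc₀, hc₀', hf₀0, hMcf⟩ := hfac v₀ hv₀ hΛ (fun z => ⟨z, hhz z⟩)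
    ⟨a₀, i₀, y₀, hMy₀⟩ d₀ f₀ hf₀
  have hLne : ∀ x : v₀.space, x ≠ 0 → L v₀ x ≠ 0 := fun x hx h0 =>
    hx (hΛ x (congrArg Subtype.val h0))
  -- forms not vanishing on `v₀` do not vanish on nearby planes
  have hnear : ∀ {t : ℕ} {u : g → k}, u ∈ forms k g t → ∀ y : v₀.space, u y ≠ 0 →
      ∀ᶠ v in nhds v₀, ∃ y : v.space, u y ≠ 0 := by
    intro t u hu y hy
    obtain ⟨x, rfl⟩ := hL_surj v₀ hΛ y
    filter_upwards [eventually_plucker_rep_ne_zero (comp_mem_forms hu (Λ.flip x)) hy] with v hv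
    exact ⟨L v x, hv⟩
  -- Injectivity of `Λ p` is joint injectivity of the functionals `η ∘ₗ Λ p`, of degree `1` in `p`.
  have hinj : ∀ᶠ v in nhds v₀, ∀ x, Λ (plucker v).rep x = 0 → x = 0 := by
    obtain ⟨t, H, hH, hH0, hH'⟩ := exists_form_of_joint_injective (N := 1) (p₀ := (plucker v₀).rep)
      (fun (η : Module.Dual k g) p => η ∘ₗ Λ p) (fun η x => dual_mem_forms (η ∘ₗ Λ.flip x))
      fun x hx => hΛ x ((Module.forall_dual_apply_eq_zero_iff k _).1 hx)
    filter_upwards [eventually_plucker_rep_ne_zero hH hH0] with v hv x hx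
    exact hH' _ hv x fun η => by simp [hx]
  have hle := exists_form_le_degree v₀.finrank_space Λ hM (fun a => (hc₀' a).1) hc₀
    (fun i => comp_mem_forms (hf₀.1 i) _)
    (fun y hy => Function.ne_iff.1 (hf₀.2 (L v₀ y) (hLne y hy)).1) hMcf
  -- The transposed matrix exchanges the factors. The tuple `c₀` has no common zero because the
  -- entries of `M` have none on `v₀`.
  have hge := exists_form_le_degree v₀.finrank_space Λ (M := fun i a => M a i) (fun i a => hM a i)
    (fun i => comp_mem_polyFun (hf₀.1 i).1 _) hf₀0 hc₀'
    (fun y hy => by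
      obtain ⟨a, i, h0⟩ := hM0 (L v₀ y) (hLne y hy)
      refine ⟨a, fun h1 => h0 ?_⟩
      have := congrFun (hMcf a i) y
      rw [Pi.mul_apply, h1, zero_mul] at this
      exact this)
    (fun i a => by rw [hMcf, mul_comm])
  obtain ⟨t, H, hH, hH0, hH'⟩ := hle
  obtain ⟨t', H', hHt, hHt0, hHt'⟩ := hge
  filter_upwards [hinj, Filter.eventually_all.2 fun z => hnear (hh z) z (hhz z),
    hnear (hM a₀ i₀) y₀ hMy₀, eventually_plucker_rep_ne_zero hH hH0,
    eventually_plucker_rep_ne_zero hHt hHt0] with v h1 h3 h4 h5 h6 hv d f hf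
  obtain ⟨s, hs, c, hc, hc', hf0, hM'⟩ := hfac v hv h1 h3 ⟨a₀, i₀, h4⟩ d f hf
  -- Now `d₀ ≤ d` and `s₀ ≤ s`, while `d + s = e = d₀ + s₀`.
  have hd := hH' _ h5 d _ _ (fun i => comp_mem_forms (hf.1 i) (L v)) hf0 hM'
  have hs := hHt' _ h6 s _ _ hc' hc fun i a => (hM' a i).trans (mul_comm _ _)
  omega

end Main

end RestrLie

open RestrLie
theorem theorem3p3 {k g : Type*} [Field k] [IsAlgClosed k] (p : ℕ) [Fact p.Prime] [CharP k p]
    (hp : 3 ≤ p) [LieRing g] [LieAlgebra k g] [FiniteDimensional k g] (P : PMap k g p)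
    (X : Set (Gr k g 2)) (hXV : X ⊆ Gr.inside 2 P.nullcone) (hX : IsClosed X)
    (m : ℕ) (φ : Projectivization k g → Projectivization k (Fin (m + 1) → k))
    (hφ : IsMorphismOn φ (projSet (Gr.union X))) :
    (∀ (v : X) (d : ℕ), HasReducedSystem (restrictProj φ v.1.space) d ↔
      d = projDegree (restrictProj φ v.1.space)) ∧
    IsLocallyConstant (fun v : X => projDegree (restrictProj φ v.1.space)) ∧
    (IsConnected X → ∀ v w : X,
      projDegree (restrictProj φ v.1.space) = projDegree (restrictProj φ w.1.space)) := by
  have hloc := hφ.locallyGivenByForms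
  have hXY : ∀ v ∈ X, ∀ (x : g) (hx : x ≠ 0), x ∈ v.space →
      Projectivization.mk k x hx ∈ projSet (Gr.union X) := fun v hv x hx hxv =>
    ⟨x, hx, Set.mem_iUnion₂.2 ⟨v, hv, hxv⟩, rfl⟩
  have hdeg : ∀ (v : X) (d : ℕ), HasReducedSystem (restrictProj φ v.1.space) d ↔
      d = projDegree (restrictProj φ v.1.space) := fun v d =>
    hasReducedSystem_iff_eq_projDegree v.1.finrank_space (hloc.restrict (hXY v v.2)) d
  have hsys : ∀ v : X, ∃ f, IsDefiningSystem (restrictProj φ v.1.space)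
      (projDegree (restrictProj φ v.1.space)) f := fun v =>
    (hasReducedSystem_iff v.1.finrank_space).1 ((hdeg v _).2 rfl)
  have hconst : IsLocallyConstant (fun v : X => projDegree (restrictProj φ v.1.space)) := by
    rw [IsLocallyConstant.iff_eventually_eq]
    intro v₀
    obtain ⟨f₀, hf₀⟩ := hsys v₀
    filter_upwards [continuous_subtype_val.continuousAt.eventually
      (hloc.eventually_degree_eq hXY v₀.2 hf₀)] with v hv
    obtain ⟨f, hf⟩ := hsys v
    exact hv v.2 _ f hf
  refine ⟨hdeg, hconst, fun hconn v w => ?_⟩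
  have : PreconnectedSpace X := Subtype.preconnectedSpace hconn.isPreconnected
  exact hconst.apply_eq_of_preconnectedSpace v w
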